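/- Let $p$ be a prime and let $(S,\mathcal F,\mathcal L)$ be a $p$-local finite group: $S$ is a finite $p$-group, $\mathcal F$ is a saturated fusion system over $S$, and $\mathcal L$ is a centric linking system associated to $\mathcal F$, with structure functors $\delta:\mathcal T^c_S(S)\to\mathcal L$ (from the transporter category of $S$ on the $\mathcal F$-centric subgroups) and $\pi:\mathcal L\to\mathcal F$. For $P,Q\in\mathrm{Ob}(\mathcal L)$ put $\iota_P=\delta_{P,S}(1)$, let $\pi_{\mathcal L}=\pi_1(|\mathcal L|,S)$ be the fundamental group of the geometric realization at the vertex $S$, and for $\varphi\in\mathrm{Mor}_{\mathcal L}(P,Q)$ let $\omega(\varphi)\in\pi_{\mathcal L}$ be the class of the loop that runs through $\iota_P$ backwards, then $\varphi$, then $\iota_Q$. Every $\mathbb Z_{(p)}[\pi_{\mathcal L}]$-module $M$ is a $\mathbb Z_{(p)}[S]$-module through $S\xrightarrow{\delta_S}\mathrm{Aut}_{\mathcal L}(S)\xrightarrow{\omega}\pi_{\mathcal L}$, and $H^*(P,M)$ denotes group cohomology for $P\le S$. Let $\Omega$ be an $\mathcal F$-characteristic $(S,S)$-biset, i.e. a finite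 left-free $(S,S)$-biset such that: every transitive component of $\Omega$ is isomorphic to $[P,\varphi]=(S\times S)/\{(u,\varphi(u)):u\in P\}$ for some $P\le S$ and $\varphi\in\mathrm{Hom}_{\mathcal F}(P,S)$; for all $P\le S$ and $\varphi\in\mathrm{Hom}_{\mathcal F}(P,S)$, restricting the left action along $\varphi$ and along the inclusion $P\le S$ gives isomorphic $(P,S)$-bisets, and likewise on the right; and $p\nmid|\Omega|/|S|$. Let $\omega_*$ be an $\Omega$-endomorphism. That is, for every transitive component of $\Omega$ choose a pair $(P,\varphi)$ such that the component is isomorphic to $[P,\varphi]$, together with a decomposition $$\varphi=\mathrm{incl}_{\varphi(P)}^S\circ\pi(\psi_r)|_{P_{r-1}}^{P_r}\circ\cdots\circ\pi(\psi_1)|_{P_0}^{P_1},\qquad P_0=P,\ P_r=\varphi(P),$$ where $\psi_i\in\mathrm{Aut}_{\mathcal L}(Q_i)$, $Q_i$ is $\mathcal F$-centric, $P_{i-1}\le Q_i$ and $\pi(\psi_i)(P_{i-1})=P_i$ (the choices do not depend on the coefficient module). For every $\mathbb Z_{(p)}[\pi_{\mathcal L}]$-module $M$ and every $n\ge 0$,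 the endomorphism $\omega_n$ of $H^n(S,M)$ is the sum over the transitive components of the composites $$\mathrm{tr}_P^S\circ H^n\big(\pi(\psi_1)|_{P_0}^{P_1},\omega(\psi_1)^{-1}\big)\circ\cdots\circ H^n\big(\pi(\psi_r)|_{P_{r-1}}^{P_r},\omega(\psi_r)^{-1}\big)\circ\mathrm{Res}^S_{\varphi(P)} .$$ Then for every finite $\mathbb Z_{(p)}[\pi_{\mathcal L}]$-module $M$ and every $n\ge 0$ there is an integer $N_{n,M}>0$ such that $\big(\tfrac{|S|}{|\Omega|}\omega_n\big)^{N_{n,M}}$ is an idempotent of $H^n(S,M)$. For any choice of such integers, the endomorphism $$\overline\omega_{n,M}=\Big(\tfrac{|S|}{|\Omega|}\,\omega_n\Big)^{\prod_{i=0}^n N_{i,M}}$$ of $H^n(S,M)$ (the $\mathcal F^c$-characteristic idempotent) is idempotent. Let $I^n_\omega(M)\subseteq H^n(S,M)$ be its image. Then the homomorphisms $H^n(S,M)\to H^n(S,M')$ induced by morphisms $M\to M'$ of finite $\mathbb Z_{(p)}[\pi_{\mathcal L}]$-modules send $I^n_\omega(M)$ into $I^n_\omega(M')$; for every short exact sequence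 $0\to M_1\to M_2\to M_3\to 0$ of such modules, the connecting homomorphism $H^n(S,M_3)\to H^{n+1}(S,M_1)$ sends $I^n_\omega(M_3)$ into $I^{n+1}_\omega(M_1)$; and $I^*_\omega(-)$, with these restricted maps and restricted connecting homomorphisms, is a cohomological $\delta$-functor from the abelian category of finite $\mathbb Z_{(p)}[\pi_{\mathcal L}]$-modules to the category of $\mathbb Z_{(p)}$-modules: the functors $I^n_\omega$ are additive, the connecting homomorphisms are natural in the short exact sequence, and every short exact sequence induces a long exact sequence $$0\to I^0_\omega(M_1)\to I^0_\omega(M_2)\to I^0_\omega(M_3)\to I^1_\omega(M_1)\to I^1_\omega(M_2)\to\cdots .$$ -/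

import Mathlib

open CategoryTheory

namespace PLocalFiniteGroup

noncomputable section

section Realization

variable (C : Type) [SmallCategory C]

/-- The geometric realization `|C|` of (the nerve of) a small category. -/
abbrev Realization : TopCat.{0} := SSet.toTop.obj (nerve C)

variable {C}

/-- The characteristic map `Δⁿ → |C|` of an `n`-simplex of the nerve of `C`, that is, of a string
of `n` composable morphisms. -/
def simplexMap {n : ℕ} (σ : ComposableArrows C n) :
    C(stdSimplex ℝ (Fin (n + 1)), Realization C) :=
  TopCat.toSSetObjEquiv (Realization C) (Opposite.op (SimplexCategory.mk n))
    ((sSetTopAdj.unit.app (nerve C)).app (Opposite.op (SimplexCategory.mk n)) σ)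

theorem simplexMap_map {m n : ℕ} (θ : SimplexCategory.mk m ⟶ SimplexCategory.mk n)
    (σ : ComposableArrows C n) (x : stdSimplex ℝ (Fin (m + 1))) :
    simplexMap ((nerve C).map θ.op σ : ComposableArrows C m) x =
      simplexMap σ (stdSimplex.map θ x) := by
  have h := NatTrans.naturality_apply (sSetTopAdj.unit.app (nerve C)) θ.op σ
  unfold simplexMap
  erw [h]
  rfl

/-- The vertex of `|C|` given by an object. -/
def vertexPt (c : C) : Realization C :=
  simplexMap (ComposableArrows.mk₀ c) (stdSimplex.vertex 0)

theorem simplexMap_vertex {n : ℕ} (σ : ComposableArrows C n) (i : Fin (n + 1)) :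
    simplexMap σ (stdSimplex.vertex i) = vertexPt (σ.obj i) := by
  have h := simplexMap_map (SimplexCategory.const (SimplexCategory.mk 0) (SimplexCategory.mk n) i) σ
    (stdSimplex.vertex 0)
  rw [stdSimplex.map_vertex] at h
  exact h.symm.trans (congrArg (fun τ : ComposableArrows C 0 =>
    simplexMap τ (stdSimplex.vertex 0)) (ComposableArrows.ext₀ rfl))

/-- The `1`-simplex of the standard simplex `Δⁿ` from the vertex `i` to the vertex `j`. -/
def stdEdge {n : ℕ} (i j : Fin (n + 1)) :
    Path (stdSimplex.vertex (S := ℝ) i) (stdSimplex.vertex j) where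
  toFun t := stdSimplex.map ![i, j] (stdSimplexHomeomorphUnitInterval.symm t)
  continuous_toFun :=
    (stdSimplex.continuous_map _).comp stdSimplexHomeomorphUnitInterval.symm.continuous
  source' := by
    have : stdSimplexHomeomorphUnitInterval.symm 0 = stdSimplex.vertex (S := ℝ) (0 : Fin 2) := by
      rw [Homeomorph.symm_apply_eq]; rfl
    rw [this, stdSimplex.map_vertex]; rfl
  target' := by
    have : stdSimplexHomeomorphUnitInterval.symm 1 = stdSimplex.vertex (S := ℝ) (1 : Fin 2) := by
      rw [Homeomorph.symm_apply_eq]; rfl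
    rw [this, stdSimplex.map_vertex]; rfl

/-- The edge of `|C|` given by a morphism `f : a ⟶ b`, as a path from the vertex `a` to the
vertex `b`. -/
def edgePath {a b : C} (f : a ⟶ b) : Path (vertexPt a) (vertexPt b) :=
  ((stdEdge (n := 1) 0 1).map (simplexMap (ComposableArrows.mk₁ f)).continuous).cast
    (simplexMap_vertex (ComposableArrows.mk₁ f) 0).symm
    (simplexMap_vertex (ComposableArrows.mk₁ f) 1).symm

theorem simplexMap_stdEdge {n : ℕ} (σ : ComposableArrows C n) {i j : Fin (n + 1)} (h : i ≤ j)
    (t : unitInterval) :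
    simplexMap σ (stdEdge i j t) =
      edgePath (σ.map (homOfLE h)) t := by
  let θ : SimplexCategory.mk 1 ⟶ SimplexCategory.mk n := SimplexCategory.mkHom
    ⟨![i, j], by
      intro x y hxy
      fin_cases x <;> fin_cases y <;> first | exact le_rfl | exact h | exact absurd hxy (by decide)⟩
  have hθ : ((nerve C).map θ.op σ : ComposableArrows C 1) = ComposableArrows.mk₁ (σ.map (homOfLE h)) :=
    ComposableArrows.ext₁ rfl rfl (by
      change _ = 𝟙 _ ≫ _ ≫ 𝟙 _
      exact ((Category.id_comp _).trans (Category.comp_id _)).symm)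
  have h1 := simplexMap_map θ σ (stdSimplexHomeomorphUnitInterval.symm t)
  rw [hθ] at h1
  refine Eq.trans h1.symm ?_
  change _ = simplexMap (ComposableArrows.mk₁ (σ.map (homOfLE h)))
    (stdSimplex.map ![(0 : Fin 2), 1] (stdSimplexHomeomorphUnitInterval.symm t))
  have : (![(0 : Fin 2), 1] : Fin 2 → Fin 2) = id := by
    funext x; fin_cases x <;> rfl
  rw [this, stdSimplex.map_id_apply]

instance contractible_stdSimplex (n : ℕ) : ContractibleSpace (stdSimplex ℝ (Fin (n + 1))) :=
  (convex_stdSimplex ℝ (Fin (n + 1))).contractibleSpace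
    ⟨_, (stdSimplex.vertex (S := ℝ) (0 : Fin (n + 1))).2⟩

/-- The functor from `C` to the fundamental groupoid of `|C|` which sends a morphism to the
homotopy class of its edge. -/
def toFundamentalGroupoid : C ⥤ FundamentalGroupoid (Realization C) where
  obj c := ⟨vertexPt c⟩
  map f := Path.Homotopic.Quotient.mk (edgePath f)
  map_id c := by
    have hp : edgePath (𝟙 c) = Path.refl (vertexPt c) := by
      apply Path.ext
      funext t
      have h := simplexMap_stdEdge (ComposableArrows.mk₀ c) (le_refl 0) t
      have hs : stdEdge (0 : Fin 1) 0 t = stdSimplex.vertex (S := ℝ) 0 := Subsingleton.elim _ _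
      rw [hs] at h
      exact h.symm
    rw [hp]
    rfl
  map_comp {a b c} f g := by
    let σ := ComposableArrows.mk₂ f g
    have hh : ((stdEdge (n := 2) 0 1).trans (stdEdge 1 2)).Homotopic (stdEdge 0 2) :=
      SimplyConnectedSpace.paths_homotopic _ _
    have hh' := (hh.map (simplexMap σ)).pathCast
      (simplexMap_vertex σ 0).symm (simplexMap_vertex σ 2).symm
    have h1 : edgePath (f ≫ g) = ((stdEdge (n := 2) 0 2).map (simplexMap σ).continuous).cast
        (simplexMap_vertex σ 0).symm (simplexMap_vertex σ 2).symm := by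
      apply Path.ext
      funext t
      exact (simplexMap_stdEdge σ (i := 0) (j := 2) (by decide) t).symm
    have h2 : (edgePath f).trans (edgePath g) =
        (((stdEdge (n := 2) 0 1).trans (stdEdge 1 2)).map (simplexMap σ).continuous).cast
        (simplexMap_vertex σ 0).symm (simplexMap_vertex σ 2).symm := by
      apply Path.ext
      funext t
      change _ = simplexMap σ (((stdEdge (n := 2) 0 1).trans (stdEdge 1 2)) t)
      rw [Path.trans_apply, Path.trans_apply]
      split_ifs with ht
      · exact (simplexMap_stdEdge σ (i := 0) (j := 1) (by decide) _).symm
      · exact (simplexMap_stdEdge σ (i := 1) (j := 2) (by decide) _).symm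
    have h3 : (edgePath (f ≫ g)).Homotopic ((edgePath f).trans (edgePath g)) := by
      rw [h1, h2]
      exact hh'.symm
    exact Quotient.sound h3

end Realization

section Transfer

variable {k G : Type} [CommRing k] [Group G] (P : Subgroup G)

/-- For a left coset `x = tP` with chosen representative `t` and a tuple `g = (g₁, …, gₙ)` of
elements of `G`, put `xᵢ = (g₁ ⋯ gᵢ)⁻¹ x` and let `tᵢ` be the chosen representative of `xᵢ`. This
is the tuple of elements `tᵢ₋₁⁻¹ gᵢ tᵢ` of `P`. -/
def transferTuple {n : ℕ} (x : G ⧸ P) (g : Fin n → G) (i : Fin n) : P :=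
  ⟨((Fin.partialProd g i.castSucc)⁻¹ • x).out⁻¹ * g i * ((Fin.partialProd g i.succ)⁻¹ • x).out, by
    rw [mul_assoc, ← QuotientGroup.eq, QuotientGroup.out_eq', Fin.partialProd_succ, ← smul_eq_mul,
      ← MulAction.Quotient.smul_mk, QuotientGroup.out_eq', mul_inv_rev, mul_smul, smul_inv_smul]⟩

theorem partialProd_transferTuple {n : ℕ} (x : G ⧸ P) (g : Fin n → G) (i : Fin (n + 1)) :
    ((Fin.partialProd (transferTuple P x g) i : P) : G) =
      x.out⁻¹ * (Fin.partialProd g i * ((Fin.partialProd g i)⁻¹ • x).out) := by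
  induction i using Fin.induction with
  | zero => simp
  | succ i ih =>
    rw [Fin.partialProd_succ, Subgroup.coe_mul, ih, transferTuple]
    simp only [Fin.partialProd_succ]
    group

theorem transferTuple_contractNth {n : ℕ} (x : G ⧸ P) (g : Fin (n + 1) → G) (j : Fin (n + 1)) :
    transferTuple P x (Fin.contractNth j (· * ·) g) =
      Fin.contractNth j (· * ·) (transferTuple P x g) := by
  funext i
  rw [← Fin.inv_partialProd_mul_eq_contractNth]
  apply Subtype.ext
  rw [Subgroup.coe_mul, Subgroup.coe_inv, partialProd_transferTuple, partialProd_transferTuple,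
    transferTuple]
  simp only
  rw [← Fin.inv_partialProd_mul_eq_contractNth, Fin.partialProd_contractNth, Function.comp_apply,
    Function.comp_apply, Fin.succ_succAbove_succ]
  group

theorem transferTuple_succ {n : ℕ} (x : G ⧸ P) (g : Fin (n + 1) → G) :
    (fun i : Fin n => transferTuple P x g i.succ) =
      transferTuple P ((g 0)⁻¹ • x) (fun i => g i.succ) := by
  funext i
  apply Subtype.ext
  have h (j : Fin (n + 1)) : (Fin.partialProd g j.succ)⁻¹ • x =
      (Fin.partialProd (fun i : Fin n => g i.succ) j)⁻¹ • (g 0)⁻¹ • x := by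
    rw [Fin.partialProd_succ', mul_inv_rev, mul_smul]
    rfl
  simp only [transferTuple, ← h]
  rfl

theorem out_mul_transferTuple_zero {n : ℕ} (x : G ⧸ P) (g : Fin (n + 1) → G) :
    x.out * (transferTuple P x g 0 : G) = g 0 * ((g 0)⁻¹ • x).out := by
  have h : Fin.partialProd g 1 = g 0 := by simpa using Fin.partialProd_succ g 0
  simp [transferTuple, h, mul_assoc]

variable [Finite G] (A : Rep k G)

/-- The transfer on inhomogeneous cochains, which sends a cochain `f : Pⁿ → A` to the cochain
`(g₁, …, gₙ) ↦ ∑ₓ tₓ f (t₀⁻¹ g₁ t₁, …, tₙ₋₁⁻¹ gₙ tₙ)` of `G`, where `x` runs through the left cosets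
of `P` in `G` and `tₓ` is the chosen representative of `x`. For `n = 0` this is the norm map
`a ↦ ∑ₓ tₓ a`. -/
def transferCochains :
    groupCohomology.inhomogeneousCochains (Rep.res P.subtype A) ⟶
      groupCohomology.inhomogeneousCochains A where
  f n := ModuleCat.ofHom (letI := Fintype.ofFinite (G ⧸ P)
    ∑ x : G ⧸ P, (A.ρ x.out).compLeft (Fin n → G) ∘ₗ LinearMap.funLeft k A (transferTuple P x))
  comm' i j hij := by
    have hij' : i + 1 = j := hij
    subst hij'
    let := Fintype.ofFinite (G ⧸ P)
    rw [groupCohomology.inhomogeneousCochains.d_def, groupCohomology.inhomogeneousCochains.d_def]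
    apply ModuleCat.hom_ext
    apply LinearMap.ext
    intro f
    funext g
    change A.ρ (g 0) ((∑ x : G ⧸ P, (A.ρ x.out).compLeft (Fin i → G) ∘ₗ
        LinearMap.funLeft k A (transferTuple P x)) f fun i => g i.succ) +
        ∑ j : Fin (i + 1), (-1 : k) ^ ((j : ℕ) + 1) • ((∑ x : G ⧸ P,
        (A.ρ x.out).compLeft (Fin i → G) ∘ₗ LinearMap.funLeft k A (transferTuple P x)) f
        (Fin.contractNth j (· * ·) g)) =
      (∑ x : G ⧸ P, (A.ρ x.out).compLeft (Fin (i + 1) → G) ∘ₗ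
        LinearMap.funLeft k A (transferTuple P x))
        (fun h : Fin (i + 1) → P => A.ρ (h 0 : G) (f fun i => h i.succ) +
        ∑ j : Fin (i + 1), (-1 : k) ^ ((j : ℕ) + 1) • f (Fin.contractNth j (· * ·) h)) g
    simp only [LinearMap.sum_apply, Finset.sum_apply, LinearMap.comp_apply,
      LinearMap.compLeft_apply, Function.comp_apply, LinearMap.funLeft_apply, map_add, map_sum,
      map_smul, Finset.sum_add_distrib, transferTuple_contractNth, transferTuple_succ]
    congr 1
    · refine (Fintype.sum_equiv (MulAction.toPerm (g 0)⁻¹) _ _ fun x => ?_).symm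
      rw [← Module.End.mul_apply, ← map_mul, out_mul_transferTuple_zero, map_mul]
      rfl
    · simp only [Finset.smul_sum]
      rw [Finset.sum_comm]

/-- The transfer (corestriction) homomorphism `Hⁿ(P, A) → Hⁿ(G, A)`. -/
def transfer (n : ℕ) : groupCohomology (Rep.res P.subtype A) n ⟶ groupCohomology A n :=
  HomologicalComplex.homologyMap (transferCochains P A) n

end Transfer

section FiniteModules

variable (k G : Type) [CommRing k] [Group G]

/-- The property of a `k`-linear representation of `G` (that is, of a `k[G]`-module) of having a
finite underlying set. -/
def isFiniteRep : ObjectProperty (Rep.{0} k G) := fun M => Finite M.V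

instance : (isFiniteRep k G).IsClosedUnderSubobjects where
  prop_of_mono f _ hY := by
    have : Finite _ := hY
    exact Finite.of_injective _ ((Rep.mono_iff_injective f).1 inferInstance)

instance : (isFiniteRep k G).IsClosedUnderQuotients where
  prop_of_epi f _ hX := by
    have : Finite _ := hX
    exact Finite.of_surjective _ ((Rep.epi_iff_surjective f).1 inferInstance)

instance : (isFiniteRep k G).ContainsZero where
  exists_zero := ⟨Rep.of (Representation.trivial k G PUnit),
    (Rep.isZero_iff k G _).2 inferInstance, inferInstanceAs (Finite PUnit)⟩

instance : (isFiniteRep k G).IsClosedUnderExtensions where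
  prop_X₂_of_shortExact {X} hX h₁ h₃ := by
    have : Finite X.X₁.V := h₁
    have : Finite X.X₃.V := h₃
    have hmod := hX.exact.map (forget₂ (Rep k G) (ModuleCat k))
    rw [ShortComplex.moduleCat_exact_iff] at hmod
    have hinj (z : X.X₃.V) : Finite (X.g.hom ⁻¹' {z}) := by
      by_cases hz : ∃ y, X.g.hom y = z
      · obtain ⟨y, rfl⟩ := hz
        refine Set.Finite.subset (Set.finite_range fun a : X.X₁.V => X.f.hom a + y) ?_
        intro w hw
        have hw' : X.g.hom (w - y) = 0 := by
          rw [map_sub, sub_eq_zero]; exact hw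
        obtain ⟨a, ha⟩ := hmod (w - y) hw'
        refine ⟨a, ?_⟩
        have ha' : X.f.hom a = w - y := ha
        simp [ha']
      · have : (X.g.hom ⁻¹' {z}) = ∅ := by
          ext w; simp only [Set.mem_preimage, Set.mem_singleton_iff, Set.mem_empty_iff_false,
            iff_false]
          exact fun h => hz ⟨w, h⟩
        rw [this]; infer_instance
    have : Finite (Σ z : X.X₃.V, (X.g.hom ⁻¹' {z})) := inferInstance
    exact Finite.of_injective (fun w : X.X₂.V =>
      (⟨X.g.hom w, w, rfl⟩ : Σ z : X.X₃.V, (X.g.hom ⁻¹' {z}))) (by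
        intro a b h
        have := congrArg (fun t : Σ z : X.X₃.V, (X.g.hom ⁻¹' {z}) => (t.2 : X.X₂.V)) h
        exact this)

instance : (isFiniteRep k G).IsClosedUnderBinaryProducts where
  limitsOfShape_le X := by
    rintro ⟨p, hp⟩
    let f : X ⟶ p.diag.obj ⟨.left⟩ ⊞ p.diag.obj ⟨.right⟩ :=
      Limits.biprod.lift (p.π.app ⟨.left⟩) (p.π.app ⟨.right⟩)
    have : Mono f := ⟨fun u v huv => p.isLimit.hom_ext (by
      rintro ⟨_ | _⟩
      · simpa [f] using congrArg (· ≫ Limits.biprod.fst) huv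
      · simpa [f] using congrArg (· ≫ Limits.biprod.snd) huv)⟩
    exact (isFiniteRep k G).prop_of_mono f ((isFiniteRep k G).prop_biprod (hp _) (hp _))

instance : (isFiniteRep k G).IsClosedUnderFiniteProducts :=
  .mk'

/-- The abelian category of finite `k[G]`-modules. -/
abbrev FiniteRep := (isFiniteRep k G).FullSubcategory

variable {k G}

instance : (isFiniteRep k G).ι.PreservesHomology where
  preservesKernels := (isFiniteRep k G).preservesKernels_ι
  preservesCokernels := (isFiniteRep k G).preservesCokernels_ι

end FiniteModules

section DeltaFunctors

variable {A B : Type*} [Category* A] [Category* B] [Abelian A] [Abelian B]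

/-- The family of functors `F⁰, F¹, …` between abelian categories, with the homomorphisms `δ`
attached to the short exact sequences of `A`, is a cohomological `δ`-functor: the functors are
additive, `δ` is natural in the short exact sequence, and every short exact sequence
`0 → X₁ → X₂ → X₃ → 0` gives a long exact sequence
`0 → F⁰ X₁ → F⁰ X₂ → F⁰ X₃ → F¹ X₁ → F¹ X₂ → ⋯`. -/
structure IsDeltaFunctor (F : ℕ → A ⥤ B)
    (δ : ∀ (n : ℕ) (X : ShortComplex A), X.ShortExact → ((F n).obj X.X₃ ⟶ (F (n + 1)).obj X.X₁)) :
    Prop where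
  additive (n : ℕ) : (F n).Additive
  naturality (n : ℕ) {X Y : ShortComplex A} (hX : X.ShortExact) (hY : Y.ShortExact) (φ : X ⟶ Y) :
    δ n X hX ≫ (F (n + 1)).map φ.τ₁ = (F n).map φ.τ₃ ≫ δ n Y hY
  mono_zero {X : ShortComplex A} (hX : X.ShortExact) : Mono ((F 0).map X.f)
  exact_middle (n : ℕ) {X : ShortComplex A} (hX : X.ShortExact) :
    ∃ w : (F n).map X.f ≫ (F n).map X.g = 0, (ShortComplex.mk _ _ w).Exact
  exact_right (n : ℕ) {X : ShortComplex A} (hX : X.ShortExact) :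
    ∃ w : (F n).map X.g ≫ δ n X hX = 0, (ShortComplex.mk _ _ w).Exact
  exact_left (n : ℕ) {X : ShortComplex A} (hX : X.ShortExact) :
    ∃ w : δ n X hX ≫ (F (n + 1)).map X.f = 0, (ShortComplex.mk _ _ w).Exact

end DeltaFunctors

section FusionSystems

variable {S : Type} [Group S]

/-- The transporter set `T_S(P, Q) = {g ∈ S | g P g⁻¹ ≤ Q}`. -/
def transporter (P Q : Subgroup S) : Set S := {g | ∀ x ∈ P, g * x * g⁻¹ ∈ Q}

/-- The conjugation homomorphism `c_g : P → Q`, `x ↦ g x g⁻¹`. -/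
def conjHom {P Q : Subgroup S} (g : S) (hg : g ∈ transporter P Q) : P →* Q :=
  ((MulAut.conj g).toMonoidHom.comp P.subtype).codRestrict Q fun x => hg x x.2

theorem one_mem_transporter {P Q : Subgroup S} (h : P ≤ Q) : (1 : S) ∈ transporter P Q :=
  fun x hx => by simpa using h hx

theorem mul_mem_transporter {P Q R : Subgroup S} {g h : S} (hh : h ∈ transporter Q R)
    (hg : g ∈ transporter P Q) : h * g ∈ transporter P R := fun x hx => by
  have := hh _ (hg x hx)
  simpa [mul_assoc] using this

theorem mem_transporter_of_mem {P : Subgroup S} {g : S} (hg : g ∈ P) : g ∈ transporter P P :=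
  fun _ hx => P.mul_mem (P.mul_mem hg hx) (P.inv_mem hg)

theorem mem_transporter_of_mem_centralizer {P : Subgroup S} {g : S}
    (hg : g ∈ Subgroup.centralizer (P : Set S)) : g ∈ transporter P P := fun x hx => by
  rw [← Subgroup.mem_centralizer_iff.1 hg x hx, mul_inv_cancel_right]
  exact hx

/-- A fusion system over `S`: a category whose objects are the subgroups of `S` and whose morphisms
are injective group homomorphisms, with composition of homomorphisms as composition, which contains
all conjugations by elements of `S`, and in which every morphism is an isomorphism of the category
followed by an inclusion. (The identities are the conjugations by `1`.) -/
structure FusionSystem (S : Type) [Group S] where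
  /-- The set of morphisms from `P` to `Q`. -/
  Hom (P Q : Subgroup S) : Set (P →* Q)
  injective {P Q : Subgroup S} {φ : P →* Q} : φ ∈ Hom P Q → Function.Injective φ
  conj_mem {P Q : Subgroup S} (g : S) (hg : g ∈ transporter P Q) : conjHom g hg ∈ Hom P Q
  comp_mem {P Q R : Subgroup S} {φ : P →* Q} {ψ : Q →* R} :
    φ ∈ Hom P Q → ψ ∈ Hom Q R → ψ.comp φ ∈ Hom P R
  factor {P Q : Subgroup S} {φ : P →* Q} : φ ∈ Hom P Q →
    ∃ (R : Subgroup S) (h : R ≤ Q) (e : P ≃* R), e.toMonoidHom ∈ Hom P R ∧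
      e.symm.toMonoidHom ∈ Hom R P ∧ φ = (Subgroup.inclusion h).comp e.toMonoidHom

namespace FusionSystem

variable (F : FusionSystem S)

/-- The set of isomorphisms from `P` to `Q` in the fusion system. -/
def Iso (P Q : Subgroup S) : Set (P ≃* Q) :=
  {e | e.toMonoidHom ∈ F.Hom P Q ∧ e.symm.toMonoidHom ∈ F.Hom Q P}

/-- Two subgroups are `F`-conjugate if they are isomorphic in `F`. -/
def IsConj (P Q : Subgroup S) : Prop := (F.Iso P Q).Nonempty

/-- `P` is `F`-centric if `C_S(Q) = Z(Q)` for all `Q` that are `F`-conjugate to `P`. -/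
def IsCentric (P : Subgroup S) : Prop :=
  ∀ Q : Subgroup S, F.IsConj P Q →
    Subgroup.centralizer (Q : Set S) = (Subgroup.center Q).map Q.subtype

/-- `P` is fully centralized if `|C_S(P)| ≥ |C_S(Q)|` for all `Q` that are `F`-conjugate to `P`. -/
def IsFullyCentralized (P : Subgroup S) : Prop :=
  ∀ Q : Subgroup S, F.IsConj P Q →
    Nat.card (Subgroup.centralizer (Q : Set S)) ≤ Nat.card (Subgroup.centralizer (P : Set S))

/-- The automorphism group `Aut_F(P)`. -/
def autF (P : Subgroup S) : Subgroup (MulAut P) where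
  carrier := F.Iso P P
  one_mem' := by
    have h : MonoidHom.id P ∈ F.Hom P P := by
      convert F.conj_mem 1 (one_mem_transporter (le_refl P)) using 1
      ext x
      simp [conjHom]
    exact ⟨h, h⟩
  mul_mem' ha hb := ⟨F.comp_mem hb.1 ha.1, F.comp_mem ha.2 hb.2⟩
  inv_mem' ha := ⟨ha.2, ha.1⟩

/-- The group `Aut_S(P)` of automorphisms of `P` given by conjugation by elements of `N_S(P)`. -/
def autS (P : Subgroup S) : Subgroup (MulAut P) := P.normalizerMonoidHom.range

/-- `P` is fully automized if `Aut_S(P)` is a Sylow `p`-subgroup of `Aut_F(P)`. -/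
def IsFullyAutomized (p : ℕ) (P : Subgroup S) : Prop :=
  ∃ T : Sylow p (F.autF P), (T : Subgroup (F.autF P)).map (F.autF P).subtype = autS P

/-- For an isomorphism `φ : Q → P`, the subgroup
`N_φ = {g ∈ N_S(Q) | φ c_g φ⁻¹ ∈ Aut_S(P)}` of `S`. -/
def extender {Q P : Subgroup S} (φ : Q ≃* P) : Subgroup S :=
  ((autS P).comap ((MulAut.congr φ).toMonoidHom.comp Q.normalizerMonoidHom)).map
    (Subgroup.normalizer (Q : Set S)).subtype

/-- `P` is receptive if every isomorphism `φ : Q → P` of `F` extends to a morphism `N_φ → S`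
of `F`. -/
def IsReceptive (P : Subgroup S) : Prop :=
  ∀ (Q : Subgroup S), ∀ φ ∈ F.Iso Q P, ∃ ψ ∈ F.Hom (extender φ) ⊤,
    ∀ (x : S) (hx : x ∈ Q) (hx' : x ∈ extender φ), (ψ ⟨x, hx'⟩ : S) = φ ⟨x, hx⟩

/-- `F` is saturated (with respect to the prime `p`) if every subgroup of `S` is `F`-conjugate to
one that is fully automized and receptive. -/
def IsSaturated (p : ℕ) : Prop :=
  ∀ P : Subgroup S, ∃ Q : Subgroup S, F.IsConj P Q ∧ F.IsFullyAutomized p Q ∧ F.IsReceptive Q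

/-- The `F`-centric subgroups of `S`. -/
abbrev Centric : Type := {P : Subgroup S // F.IsCentric P}

theorem isCentric_top [Finite S] : F.IsCentric ⊤ := by
  rintro Q ⟨e, -⟩
  obtain rfl : Q = ⊤ := by
    apply Subgroup.eq_top_of_card_eq
    rw [← Nat.card_congr e.toEquiv, Subgroup.card_top]
  ext x
  simp only [Subgroup.coe_top, Subgroup.centralizer_univ, Subgroup.mem_map,
    Subgroup.mem_center_iff, Subgroup.coe_subtype]
  constructor
  · exact fun h => ⟨⟨x, trivial⟩, fun g => Subtype.ext (h g), rfl⟩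
  · rintro ⟨y, hy, rfl⟩ g
    exact congrArg Subtype.val (hy ⟨g, trivial⟩)

/-- The group `S` itself, as an `F`-centric subgroup. -/
def top [Finite S] : F.Centric := ⟨⊤, F.isCentric_top⟩

end FusionSystem

/-- A centric linking system associated to `F`: a finite category whose objects are the `F`-centric
subgroups of `S`, with a functor `δ` from the transporter category of `S` on these subgroups and a
functor `π` to `F`, which are the identity and the inclusion on objects, such that the conditions
(A), (B) and (C) hold. -/
structure LinkingSystem (F : FusionSystem S) where
  /-- The morphisms from `P` to `Q`. -/
  Mor (P Q : F.Centric) : Type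
  finite_mor (P Q : F.Centric) : Finite (Mor P Q)
  /-- The identity morphisms. -/
  id (P : F.Centric) : Mor P P
  /-- The composite `ψ ∘ φ`. -/
  comp {P Q R : F.Centric} (φ : Mor P Q) (ψ : Mor Q R) : Mor P R
  id_comp {P Q : F.Centric} (φ : Mor P Q) : comp (id P) φ = φ
  comp_id {P Q : F.Centric} (φ : Mor P Q) : comp φ (id Q) = φ
  assoc {P Q R T : F.Centric} (φ : Mor P Q) (ψ : Mor Q R) (χ : Mor R T) :
    comp (comp φ ψ) χ = comp φ (comp ψ χ)
  /-- The functor `δ` on morphisms. -/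
  δ {P Q : F.Centric} (g : S) (hg : g ∈ transporter P.1 Q.1) : Mor P Q
  δ_one (P : F.Centric) : δ 1 (one_mem_transporter (le_refl P.1)) = id P
  δ_mul {P Q R : F.Centric} (g h : S) (hg : g ∈ transporter P.1 Q.1) (hh : h ∈ transporter Q.1 R.1) :
    δ (h * g) (mul_mem_transporter hh hg) = comp (δ g hg) (δ h hh)
  /-- The functor `π` on morphisms. -/
  π {P Q : F.Centric} (φ : Mor P Q) : P.1 →* Q.1
  π_mem {P Q : F.Centric} (φ : Mor P Q) : π φ ∈ F.Hom P.1 Q.1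
  π_id (P : F.Centric) : π (id P) = MonoidHom.id P.1
  π_comp {P Q R : F.Centric} (φ : Mor P Q) (ψ : Mor Q R) : π (comp φ ψ) = (π ψ).comp (π φ)
  /-- (A), first part: `C_S(P)` acts freely on the morphisms from `P` to `Q`. -/
  free {P Q : F.Centric} (hP : F.IsFullyCentralized P.1) (φ : Mor P Q) (u : S)
    (hu : u ∈ Subgroup.centralizer (P.1 : Set S)) :
    comp (δ u (mem_transporter_of_mem_centralizer hu)) φ = φ → u = 1
  /-- (A), second part: `π` is the orbit map for this action onto the morphisms of `F`. -/
  π_surjective {P Q : F.Centric} (hP : F.IsFullyCentralized P.1) (α : P.1 →* Q.1)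
    (hα : α ∈ F.Hom P.1 Q.1) : ∃ φ : Mor P Q, π φ = α
  π_eq_iff {P Q : F.Centric} (hP : F.IsFullyCentralized P.1) (φ ψ : Mor P Q) :
    π φ = π ψ ↔ ∃ (u : S) (hu : u ∈ Subgroup.centralizer (P.1 : Set S)),
      ψ = comp (δ u (mem_transporter_of_mem_centralizer hu)) φ
  /-- (B) -/
  π_δ {P Q : F.Centric} (g : S) (hg : g ∈ transporter P.1 Q.1) : π (δ g hg) = conjHom g hg
  /-- (C) -/
  δ_comp {P Q : F.Centric} (ψ : Mor P Q) (g : P.1) :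
    comp (δ (g : S) (mem_transporter_of_mem g.2)) ψ =
      comp ψ (δ (π ψ g : S) (mem_transporter_of_mem (π ψ g).2))

namespace LinkingSystem

variable {F : FusionSystem S} (L : LinkingSystem F)

/-- The objects of the category `L`. -/
structure Obj (L : LinkingSystem F) where
  /-- The underlying `F`-centric subgroup. -/
  subgp : F.Centric

instance : SmallCategory L.Obj where
  Hom P Q := L.Mor P.subgp Q.subgp
  id P := L.id P.subgp
  comp φ ψ := L.comp φ ψ
  id_comp φ := L.id_comp φ
  comp_id φ := L.comp_id φ
  assoc φ ψ χ := L.assoc φ ψ χ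

variable {L}

/-- The subgroup of `S` underlying an object of `L`. -/
abbrev Obj.gp (P : L.Obj) : Subgroup S := P.subgp.1

/-- The morphism `δ_{P,Q}(g)` of the category `L`. -/
def ofTransporter {P Q : L.Obj} (g : S) (hg : g ∈ transporter P.gp Q.gp) : P ⟶ Q := L.δ g hg

/-- The homomorphism `π(φ) : P → Q` underlying a morphism `φ` of the category `L`. -/
def toHom {P Q : L.Obj} (φ : P ⟶ Q) : P.gp →* Q.gp := L.π φ

theorem ofTransporter_comp {P Q R : L.Obj} (g h : S) (hg : g ∈ transporter P.gp Q.gp)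
    (hh : h ∈ transporter Q.gp R.gp) :
    (ofTransporter g hg : P ⟶ Q) ≫ (ofTransporter h hh : Q ⟶ R) =
      ofTransporter (h * g) (mul_mem_transporter hh hg) :=
  (L.δ_mul g h hg hh).symm

theorem ofTransporter_comp_eq {P Q : L.Obj} (ψ : P ⟶ Q) (g : P.gp) :
    (ofTransporter (g : S) (mem_transporter_of_mem g.2) : P ⟶ P) ≫ ψ =
      ψ ≫ (ofTransporter (toHom ψ g : S) (mem_transporter_of_mem (toHom ψ g).2) : Q ⟶ Q) :=
  L.δ_comp ψ g

variable [Finite S] (L)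

/-- The object `S` of `L`. -/
def topObj : L.Obj := ⟨F.top⟩

theorem mem_transporter_topObj (P : Subgroup S) (g : S) : g ∈ transporter P L.topObj.gp :=
  fun _ _ => trivial

/-- The fundamental group `π_L = π₁(|L|, S)` of the geometric realization of `L`, based at the
vertex `S`. The product `a * b` is the class of the loop `b` followed by the loop `a`. -/
abbrev fundGroup : Type := FundamentalGroup (Realization L.Obj) (vertexPt L.topObj)

variable {L}

/-- The morphism `ι_P = δ_{P,S}(1)` from `P` to `S`. -/
def inclTop (P : L.Obj) : P ⟶ L.topObj := ofTransporter 1 (L.mem_transporter_topObj P.gp 1)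

/-- The functor `ω` on morphisms: `ω(φ)` is the class of the loop at `S` which runs through
the edge `ι_P` backwards, then through the edge `φ`, and then through the edge `ι_Q`. -/
def loopClass {P Q : L.Obj} (φ : P ⟶ Q) : L.fundGroup :=
  (inv (toFundamentalGroupoid.map (inclTop P)) ≫ toFundamentalGroupoid.map φ ≫
    toFundamentalGroupoid.map (inclTop Q) :
      toFundamentalGroupoid.obj L.topObj ⟶ toFundamentalGroupoid.obj L.topObj)

theorem functor_loop_comp {C D : Type*} [Category* C] [Groupoid D] (E : C ⥤ D) {t P Q R : C}
    (i : P ⟶ t) (j : Q ⟶ t) (l : R ⟶ t) (φ : P ⟶ Q) (ψ : Q ⟶ R) :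
    inv (E.map i) ≫ E.map (φ ≫ ψ) ≫ E.map l =
      (inv (E.map i) ≫ E.map φ ≫ E.map j) ≫ inv (E.map j) ≫ E.map ψ ≫ E.map l := by
  simp

theorem functor_loop_eq {C D : Type*} [Category* C] [Groupoid D] (E : C ⥤ D) {t P Q : C}
    (i : P ⟶ t) (j : Q ⟶ t) (l : t ⟶ t) (hl : l = 𝟙 t) (φ : P ⟶ Q) (ψ : t ⟶ t)
    (h : φ ≫ j = i ≫ ψ) :
    inv (E.map i) ≫ E.map φ ≫ E.map j = inv (E.map l) ≫ E.map ψ ≫ E.map l := by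
  subst hl
  rw [← E.map_comp, h]
  simp

theorem loopClass_comp {P Q R : L.Obj} (φ : P ⟶ Q) (ψ : Q ⟶ R) :
    loopClass (φ ≫ ψ) = loopClass ψ * loopClass φ := by
  exact functor_loop_comp toFundamentalGroupoid _ _ _ φ ψ

theorem inclTop_topObj : inclTop L.topObj = 𝟙 L.topObj := L.δ_one F.top

variable (L) in
/-- The homomorphism `S → π_L`, `g ↦ ω(δ_S(g))`. -/
def fromS : S →* L.fundGroup where
  toFun g := loopClass (ofTransporter g (L.mem_transporter_topObj L.topObj.gp g) : L.topObj ⟶ L.topObj)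
  map_one' := by
    have h : (ofTransporter 1 (L.mem_transporter_topObj L.topObj.gp 1) : L.topObj ⟶ L.topObj) = 𝟙 L.topObj :=
      L.δ_one F.top
    rw [h]
    exact (congrArg (_ ≫ ·) ((congrArg (· ≫ _) (toFundamentalGroupoid.map_id _)).trans
      (Category.id_comp _))).trans (IsIso.inv_hom_id _)
  map_mul' g h := by
    rw [← loopClass_comp]
    exact congrArg loopClass (L.δ_mul h g _ _)

theorem loopClass_ofTransporter {P Q : L.Obj} (g : S) (hg : g ∈ transporter P.gp Q.gp) :
    loopClass (ofTransporter g hg : P ⟶ Q) = L.fromS g := by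
  have h : (ofTransporter g hg : P ⟶ Q) ≫ inclTop Q =
      inclTop P ≫ (ofTransporter g (L.mem_transporter_topObj L.topObj.gp g) : L.topObj ⟶ L.topObj) := by
    rw [inclTop, inclTop, ofTransporter_comp, ofTransporter_comp]
    simp
  exact functor_loop_eq toFundamentalGroupoid _ _ _ inclTop_topObj _ _ h

theorem fromS_mul_inv_loopClass {P Q : L.Obj} (ψ : P ⟶ Q) (g : P.gp) :
    L.fromS (g : S) * (loopClass ψ)⁻¹ = (loopClass ψ)⁻¹ * L.fromS (toHom ψ g : S) := by
  rw [mul_inv_eq_iff_eq_mul, mul_assoc, eq_inv_mul_iff_mul_eq]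
  have h := congrArg loopClass (ofTransporter_comp_eq ψ g)
  rw [loopClass_comp, loopClass_comp, loopClass_ofTransporter, loopClass_ofTransporter] at h
  exact h

section Coefficients

variable {k : Type} [CommRing k]

variable (L) in
/-- A `k[π_L]`-module as a `k[S]`-module, by restriction along `S → π_L`. -/
abbrev coeff (M : Rep.{0} k L.fundGroup) : Rep.{0} k S := Rep.res L.fromS M

variable (L) in
/-- A `k[π_L]`-module as a `k[P]`-module, for a subgroup `P` of `S`. -/
abbrev coeffOn (M : Rep.{0} k L.fundGroup) (P : Subgroup S) : Rep.{0} k P :=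
  Rep.res P.subtype (L.coeff M)

/-- The restriction `P₀ → P₁` of `π(ψ)` to subgroups `P₀` and `P₁` of `Q` with
`π(ψ)(P₀) = P₁`. -/
def restrictHom {Q : L.Obj} (ψ : Q ⟶ Q) {P₀ P₁ : Subgroup S} (h₀ : P₀ ≤ Q.gp)
    (h₁ : (P₀.subgroupOf Q.gp).map (Q.gp.subtype.comp (toHom ψ)) = P₁) : P₀ →* P₁ :=
  (Q.gp.subtype.comp ((toHom ψ).comp (Subgroup.inclusion h₀))).codRestrict P₁ fun x => by
    rw [← h₁]
    exact ⟨⟨x, h₀ x.2⟩, x.2, rfl⟩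

/-- The map `M → M`, `x ↦ ω(ψ)⁻¹ x`, which is compatible with the restriction `P₀ → P₁`
of `π(ψ)`. -/
def restrictAct {Q : L.Obj} (ψ : Q ⟶ Q) {P₀ P₁ : Subgroup S} (h₀ : P₀ ≤ Q.gp)
    (h₁ : (P₀.subgroupOf Q.gp).map (Q.gp.subtype.comp (toHom ψ)) = P₁)
    (M : Rep.{0} k L.fundGroup) :
    Rep.res (restrictHom ψ h₀ h₁) (L.coeffOn M P₁) ⟶ L.coeffOn M P₀ :=
  Rep.ofHom ⟨M.ρ (loopClass ψ)⁻¹, fun g => by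
    have h := congrArg M.ρ (fromS_mul_inv_loopClass ψ (Subgroup.inclusion h₀ g))
    rw [map_mul, map_mul] at h
    exact h.symm⟩

variable (L) in
/-- A composable string of restrictions
`P = P₀ → P₁ → ⋯ → P_r = R` of homomorphisms `π(ψ₁), …, π(ψ_r)`, where `ψ_i` is an automorphism in
`L` of an `F`-centric subgroup `Q_i` which contains `P_{i-1}`, and `π(ψ_i)(P_{i-1}) = P_i`. -/
inductive AutChain : Subgroup S → Subgroup S → Type
  | nil (P : Subgroup S) : AutChain P P
  | cons {P₀ P₁ R : Subgroup S} (Q : L.Obj) (ψ : Q ≅ Q) (h₀ : P₀ ≤ Q.gp)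
      (h₁ : (P₀.subgroupOf Q.gp).map (Q.gp.subtype.comp (toHom ψ.hom)) = P₁)
      (c : AutChain P₁ R) : AutChain P₀ R

namespace AutChain

/-- The composite homomorphism `P → R`. -/
def toMonoidHom : {P R : Subgroup S} → L.AutChain P R → (P →* R)
  | _, _, nil P => MonoidHom.id P
  | _, _, cons _ ψ h₀ h₁ c => c.toMonoidHom.comp (restrictHom ψ.hom h₀ h₁)

/-- The composite `Hⁿ(R, M) → Hⁿ(P, M)` of the maps `Hⁿ(π(ψ_i)|, ω(ψ_i)⁻¹)`. -/
def cohomologyMap (M : Rep.{0} k L.fundGroup) (n : ℕ) : {P R : Subgroup S} → L.AutChain P R →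
    (groupCohomology (L.coeffOn M R) n ⟶ groupCohomology (L.coeffOn M P) n)
  | _, _, nil _ => 𝟙 _
  | _, _, cons _ ψ h₀ h₁ c => c.cohomologyMap M n ≫
      groupCohomology.map (restrictHom ψ.hom h₀ h₁) (restrictAct ψ.hom h₀ h₁ M) n

end AutChain

/-- The `[P, φ]`-endomorphism `tr_P^S ∘ H(π(ψ₁)|, ω(ψ₁)⁻¹) ∘ ⋯ ∘ H(π(ψ_r)|, ω(ψ_r)⁻¹) ∘ Res_R^S` of
`Hⁿ(S, M)` given by a decomposition of `φ : P → R ≤ S` into restrictions of automorphisms. -/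
def AutChain.endomorphism {P R : Subgroup S} (c : L.AutChain P R) (M : Rep.{0} k L.fundGroup)
    (n : ℕ) : groupCohomology (L.coeff M) n ⟶ groupCohomology (L.coeff M) n :=
  groupCohomology.map R.subtype (𝟙 (L.coeffOn M R)) n ≫ c.cohomologyMap M n ≫
    transfer P (L.coeff M) n

end Coefficients

end LinkingSystem

end FusionSystems

section Bisets

/-! A `(G, H)`-biset is the same as a set with a left action of `G × H`, where `(g, h)` acts
by `x ↦ g x h⁻¹`. -/

variable {S : Type} [Group S]

/-- The subgroup `Δ(P, φ) = {(u, φ(u)) | u ∈ P}` of `S × S`. -/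
def graph (P : Subgroup S) (φ : P →* (⊤ : Subgroup S)) : Subgroup (S × S) :=
  (P.subtype.prod ((⊤ : Subgroup S).subtype.comp φ)).range

/-- The orbit `o` of an `(S, S)`-biset is isomorphic to `[P, φ] = (S × S) / Δ(P, φ)`. -/
def IsOfType {Ω : Type*} [MulAction (S × S) Ω] (o : MulAction.orbitRel.Quotient (S × S) Ω)
    (P : Subgroup S) (φ : P →* (⊤ : Subgroup S)) : Prop :=
  ∃ f : o.orbit ≃ (S × S) ⧸ graph P φ, ∀ (a : S × S) (x : o.orbit), f (a • x) = a • f x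

/-- An `F`-characteristic `(S, S)`-biset: a finite, left-free `(S, S)`-biset which is `F`-generated,
left-`F`-stable, right-`F`-stable and non degenerate. -/
structure IsCharacteristicBiset (p : ℕ) (F : FusionSystem S) (Ω : Type*) [Finite Ω]
    [MulAction (S × S) Ω] : Prop where
  left_free (g : S) (x : Ω) : (g, (1 : S)) • x = x → g = 1
  generated (o : MulAction.orbitRel.Quotient (S × S) Ω) :
    ∃ (P : Subgroup S), ∃ φ ∈ F.Hom P ⊤, IsOfType o P φ
  left_stable (P : Subgroup S) : ∀ φ ∈ F.Hom P ⊤,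
    ∃ f : Ω ≃ Ω, ∀ (u : P) (s : S) (x : Ω), f (((φ u : S), s) • x) = ((u : S), s) • f x
  right_stable (P : Subgroup S) : ∀ φ ∈ F.Hom P ⊤,
    ∃ f : Ω ≃ Ω, ∀ (s : S) (u : P) (x : Ω), f ((s, (φ u : S)) • x) = (s, (u : S)) • f x
  nondegenerate : ¬ p ∣ Nat.card Ω / Nat.card S

variable [Finite S] {F : FusionSystem S}

/-- The choices which define an `Ω`-endomorphism: for every transitive component of `Ω`, a subgroup
`P` and a homomorphism `φ : P → S` such that the component is isomorphic to `[P, φ]`, where `φ` is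
given with a decomposition into restrictions of automorphisms in `L` of `F`-centric subgroups,
followed by an inclusion. -/
structure OmegaEndomorphism (L : LinkingSystem F) (Ω : Type*) [MulAction (S × S) Ω] where
  /-- The subgroup `P`. -/
  source : MulAction.orbitRel.Quotient (S × S) Ω → Subgroup S
  /-- The subgroup `φ(P)`. -/
  target : MulAction.orbitRel.Quotient (S × S) Ω → Subgroup S
  /-- The decomposition of `φ`. -/
  chain (o : MulAction.orbitRel.Quotient (S × S) Ω) : L.AutChain (source o) (target o)
  isOfType (o : MulAction.orbitRel.Quotient (S × S) Ω) :
    IsOfType o (source o) ((Subgroup.inclusion le_top).comp (chain o).toMonoidHom)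

end Bisets

section Idempotents

/-- The localization `ℤ_(p)` of `ℤ` at the prime ideal `(p)`. -/
abbrev ZLoc (p : ℕ) [Fact p.Prime] : Type :=
  haveI : (Ideal.span {(p : ℤ)}).IsPrime :=
    (Ideal.span_singleton_prime (Nat.cast_ne_zero.2 (Fact.out : p.Prime).ne_zero)).2
      (Nat.prime_iff_prime_int.1 Fact.out)
  Localization.AtPrime (Ideal.span {(p : ℤ)})

variable {p : ℕ} [Fact p.Prime] {S : Type} [Group S] [Finite S] {F : FusionSystem S}
  {L : LinkingSystem F} {Ω : Type*} [Finite Ω] [MulAction (S × S) Ω]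

variable (p L) in
/-- The abelian category of finite `ℤ_(p)[π_L]`-modules. -/
abbrev CoeffMod := FiniteRep (ZLoc p) L.fundGroup

variable (p L) in
/-- The exact functor from finite `ℤ_(p)[π_L]`-modules to `ℤ_(p)[S]`-modules. -/
abbrev toRepS : CoeffMod p L ⥤ Rep.{0} (ZLoc p) S :=
  (isFiniteRep (ZLoc p) L.fundGroup).ι ⋙ Rep.resFunctor L.fromS

theorem shortExact_toRepS {X : ShortComplex (CoeffMod p L)} (hX : X.ShortExact) :
    (X.map (toRepS p L)).ShortExact := by
  have := (isFiniteRep (ZLoc p) L.fundGroup).preservesMonomorphisms_ι_of_isNormalEpiCategory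
  have := (isFiniteRep (ZLoc p) L.fundGroup).preservesEpimorphisms_ι_of_isNormalMonoCategory
  have := hX.mono_f
  have := hX.epi_g
  have h := hX.map (isFiniteRep (ZLoc p) L.fundGroup).ι
  exact (Rep.shortExact_res L.fromS).2 h

variable (p L) in
/-- The functor `Hⁿ(S, -)` on finite `ℤ_(p)[π_L]`-modules. -/
abbrev cohomologyS (n : ℕ) : CoeffMod p L ⥤ ModuleCat.{0} (ZLoc p) :=
  toRepS p L ⋙ groupCohomology.functor (ZLoc p) S n

/-- The connecting homomorphism `Hⁿ(S, X₃) → Hⁿ⁺¹(S, X₁)` of a short exact sequence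
`0 → X₁ → X₂ → X₃ → 0` of finite `ℤ_(p)[π_L]`-modules. -/
def connecting (n : ℕ) (X : ShortComplex (CoeffMod p L)) (hX : X.ShortExact) :
    (cohomologyS p L n).obj X.X₃ ⟶ (cohomologyS p L (n + 1)).obj X.X₁ :=
  groupCohomology.δ (shortExact_toRepS hX) n (n + 1) rfl

namespace OmegaEndomorphism

variable (w : OmegaEndomorphism L Ω)

/-- The endomorphism `ω_n` of `Hⁿ(S, M)`, the sum over the transitive components of `Ω`. -/
def endo (M : CoeffMod p L) (n : ℕ) :
    Module.End (ZLoc p) ((cohomologyS p L n).obj M) :=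
  letI := Fintype.ofFinite (MulAction.orbitRel.Quotient (S × S) Ω)
  ∑ o, ((w.chain o).endomorphism M.obj n).hom

/-- The endomorphism `(|S| / |Ω|) ω_n` of `Hⁿ(S, M)`; if `Ω` is non degenerate, then the integer
`|Ω| / |S|` is a unit of `ℤ_(p)`. -/
def normalized (M : CoeffMod p L) (n : ℕ) :
    Module.End (ZLoc p) ((cohomologyS p L n).obj M) :=
  Ring.inverse ((Nat.card Ω / Nat.card S : ℕ) : ZLoc p) • w.endo M n

/-- The numbers `N n M > 0` are such that the powers `((|S| / |Ω|) ω_n) ^ (N n M)` are idempotent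
endomorphisms of `Hⁿ(S, M)`. -/
def IsExponents (N : ℕ → CoeffMod p L → ℕ) : Prop :=
  ∀ (n : ℕ) (M : CoeffMod p L), 0 < N n M ∧ IsIdempotentElem (w.normalized M n ^ N n M)

/-- The `F^c`-characteristic idempotent associated to `ω`, which is the endomorphism
`((|S| / |Ω|) ω_n) ^ (N 0 M ⋯ N n M)` of `Hⁿ(S, M)`. -/
def charIdempotent (N : ℕ → CoeffMod p L → ℕ) (M : CoeffMod p L) (n : ℕ) :
    Module.End (ZLoc p) ((cohomologyS p L n).obj M) :=
  w.normalized M n ^ ∏ i ∈ Finset.range (n + 1), N i M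

/-- The image `I_ωⁿ(M) ⊆ Hⁿ(S, M)` of the `F^c`-characteristic idempotent. -/
def image (N : ℕ → CoeffMod p L → ℕ) (M : CoeffMod p L) (n : ℕ) :
    Submodule (ZLoc p) ((cohomologyS p L n).obj M) :=
  LinearMap.range (w.charIdempotent N M n)

/-- The functor `I_ωⁿ(-)`, a subfunctor of `Hⁿ(S, -)` if the homomorphisms induced by morphisms of
coefficient modules restrict to the images. -/
def imageFunctor (N : ℕ → CoeffMod p L → ℕ)
    (hmap : ∀ (n : ℕ) (M M' : CoeffMod p L) (f : M ⟶ M'), ∀ x ∈ w.image N M n,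
      ((cohomologyS p L n).map f).hom x ∈ w.image N M' n) (n : ℕ) :
    CoeffMod p L ⥤ ModuleCat.{0} (ZLoc p) where
  obj M := ModuleCat.of (ZLoc p) (w.image N M n)
  map {M M'} f := ModuleCat.ofHom (((cohomologyS p L n).map f).hom.restrict (hmap n M M' f))
  map_id M := by
    apply ModuleCat.hom_ext
    apply LinearMap.ext
    intro x
    apply Subtype.ext
    exact congrArg (fun g => g.hom (x : (cohomologyS p L n).obj M)) ((cohomologyS p L n).map_id M)
  map_comp {M M' M''} f g := by
    apply ModuleCat.hom_ext
    apply LinearMap.ext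
    intro x
    apply Subtype.ext
    exact congrArg (fun g => g.hom (x : (cohomologyS p L n).obj M)) ((cohomologyS p L n).map_comp f g)

/-- The connecting homomorphism of `H^*(S, -)`, restricted to `I_ω^*(-)`. -/
def imageConnecting (N : ℕ → CoeffMod p L → ℕ)
    (hδ : ∀ (n : ℕ) (X : ShortComplex (CoeffMod p L)) (hX : X.ShortExact), ∀ x ∈ w.image N X.X₃ n,
      (connecting n X hX).hom x ∈ w.image N X.X₁ (n + 1))
    (n : ℕ) (X : ShortComplex (CoeffMod p L)) (hX : X.ShortExact) :
    ModuleCat.of (ZLoc p) (w.image N X.X₃ n) ⟶ ModuleCat.of (ZLoc p) (w.image N X.X₁ (n + 1)) :=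
  ModuleCat.ofHom ((connecting n X hX).hom.restrict (hδ n X hX))

end OmegaEndomorphism

end Idempotents

end

end PLocalFiniteGroup

open CategoryTheory

namespace PLocalFiniteGroup

/-! If a positive power of an endomorphism `f` of a module is idempotent, its range is the eventual
image of `f`. Any two positive idempotent powers `f ^ m` and `f ^ n` agree, both being `f ^ (m *
n)`, so the choice of exponent does not matter. A linear map that intertwines two such endomorphisms
preserves eventual images (`map_mem_range_pow`), and an exact pair of maps stays exact on them
(`exact_restrict_range_pow`), because an intertwining map carries a suitable power of `f` to the
same power of `g`.

The theorem thus reduces to two facts. First, idempotent powers exist: for a finite group and a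
finite module the cohomology is finite, hence so is its endomorphism monoid. Second, the normalized
`ω_n` commutes with coefficient maps and with connecting homomorphisms (`map_normalized`,
`connecting_normalized`). For each component of `Ω` the contribution to `ω_n` comes from one cochain
endomorphism, built from restrictions, actions of elements `ω(ψ)⁻¹` of `π_L` and a transfer. It is
natural in the `π_L`-module because the choices do not involve the module
(`endomorphismCochains_naturality`). It therefore acts on the short exact sequence of cochain
complexes behind the long exact sequence of `H^*(S, -)`. -/

/-! ### Idempotent powers in a finite monoid. -/

theorem exists_pow_isIdempotentElem {M : Type*} [Monoid M] [Finite M] (f : M) :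
    ∃ n : ℕ, 0 < n ∧ IsIdempotentElem (f ^ n) := by
  obtain ⟨a, b, hab, h⟩ : ∃ a b : ℕ, a < b ∧ f ^ a = f ^ b := by
    obtain ⟨a, b, hne, h⟩ := Finite.exists_ne_map_eq_of_infinite fun n : ℕ => f ^ n
    rcases hne.lt_or_gt with h' | h'
    · exact ⟨a, b, h', h⟩
    · exact ⟨b, a, h', h.symm⟩
  -- From the exponent `a` on, the powers of `f` are periodic with period `b - a`.
  have hper (k m : ℕ) (hm : a ≤ m) : f ^ (m + (b - a) * k) = f ^ m := by
    induction k with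
    | zero => simp
    | succ k ih =>
      rw [← ih, show m + (b - a) * (k + 1) = b + (m - a + (b - a) * k) by
          rw [mul_add]; omega, pow_add, ← h, ← pow_add]
      congr 1
      omega
  have hpos : 0 < b - a := by omega
  -- The exponent must be a positive multiple of the period that is at least `a`; doubling it then
  -- does not change the power. The factor `a + 1` keeps it positive when `a = 0`.
  refine ⟨(b - a) * (a + 1), by positivity, ?_⟩
  rw [IsIdempotentElem, ← pow_add]
  exact hper _ _ (by nlinarith)

/-! ### Eventual images of commuting endomorphisms. -/

section StableImage

variable {k A B C : Type*} [CommRing k] [AddCommGroup A] [Module k A] [AddCommGroup B] [Module k B]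
  [AddCommGroup C] [Module k C]

theorem apply_eq_of_mem_range_isIdempotentElem {e : Module.End k A} (he : IsIdempotentElem e) {x : A}
    (hx : x ∈ LinearMap.range e) : e x = x := by
  obtain ⟨y, rfl⟩ := hx
  exact LinearMap.congr_fun he y

theorem pow_comm_apply {φ : A →ₗ[k] B} {f : Module.End k A} {g : Module.End k B}
    (h : ∀ x, φ (f x) = g (φ x)) (n : ℕ) (x : A) : φ ((f ^ n) x) = (g ^ n) (φ x) := by
  induction n with
  | zero => rfl
  | succ n ih => rw [pow_succ', pow_succ', Module.End.mul_apply, Module.End.mul_apply, h, ih]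

/-- This reduces commutation with the normalized `ω_n` to a single component of `Ω`. -/
theorem smul_sum_comm_apply {ι : Type*} (s : Finset ι) (c : k) {φ : A →ₗ[k] B}
    {f : ι → Module.End k A} {g : ι → Module.End k B} (h : ∀ i x, φ (f i x) = g i (φ x)) (x : A) :
    φ ((c • ∑ i ∈ s, f i) x) = (c • ∑ i ∈ s, g i) (φ x) := by
  simp only [LinearMap.smul_apply, map_smul, LinearMap.sum_apply, map_sum, h]

/-- The case `n = 0` is set apart because `f ^ 0` is the identity, whose range is everything. -/
theorem range_pow_mul_le (f : Module.End k A) (m n : ℕ) :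
    LinearMap.range (f ^ (m * n)) ≤ LinearMap.range (f ^ m) ∨ n = 0 := by
  rcases n with _ | n
  · exact .inr rfl
  · left
    rw [mul_add, mul_one, add_comm, pow_add]
    exact LinearMap.range_comp_le_range _ _

/-- The image of an idempotent power of an endomorphism is the eventual image, so that it is
functorial for maps which commute with the endomorphisms. -/
theorem map_mem_range_pow {φ : A →ₗ[k] B} {f : Module.End k A} {g : Module.End k B}
    (h : ∀ x, φ (f x) = g (φ x)) {m n : ℕ} (hm : 0 < m) (hf : IsIdempotentElem (f ^ m)) {x : A}
    (hx : x ∈ LinearMap.range (f ^ m)) : φ x ∈ LinearMap.range (g ^ n) := by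
  -- The exponent is a multiple of `m`, so that the power fixes `x`, and a multiple of `n`, so that
  -- the corresponding power of `g` lands in the range of `g ^ n`.
  have hx' : (f ^ (n * m)) x = x := by
    rcases n with _ | n
    · simp
    · rw [mul_comm, pow_mul, hf.pow_eq n.succ_ne_zero]
      exact apply_eq_of_mem_range_isIdempotentElem hf hx
  rw [← hx', pow_comm_apply h]
  exact ((range_pow_mul_le g n m).resolve_right hm.ne') ⟨_, rfl⟩

/-- A preimage `x` of `y` under `φ` need not lie in the range of `f ^ m`, but `(f ^ (m * n)) x`
does, and it maps to `(g ^ (m * n)) y = y`. Idempotency is needed only for the middle term, and `m`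
and `n` need not be related. -/
theorem exact_restrict_range_pow {φ : A →ₗ[k] B} {ψ : B →ₗ[k] C} (hex : Function.Exact φ ψ)
    {f : Module.End k A} {g : Module.End k B} (h : ∀ x, φ (f x) = g (φ x)) {m n : ℕ}
    (hn : 0 < n) (hg : IsIdempotentElem (g ^ n))
    (p : Submodule k C) (hφ : ∀ x ∈ LinearMap.range (f ^ m), φ x ∈ LinearMap.range (g ^ n))
    (hψ : ∀ y ∈ LinearMap.range (g ^ n), ψ y ∈ p) :
    Function.Exact (φ.restrict hφ) (ψ.restrict hψ) := by
  rintro ⟨y, hy⟩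
  constructor
  · intro hy0
    obtain ⟨x, hx⟩ := (hex y).1 (congrArg Subtype.val hy0)
    refine ⟨⟨(f ^ (m * n)) x, (range_pow_mul_le f m n).resolve_right hn.ne' ⟨_, rfl⟩⟩,
      Subtype.ext ?_⟩
    change φ ((f ^ (m * n)) x) = y
    rw [pow_comm_apply h, hx]
    rcases m with _ | m
    · simp
    · rw [mul_comm, pow_mul, hg.pow_eq m.succ_ne_zero]
      exact apply_eq_of_mem_range_isIdempotentElem hg hy
  · rintro ⟨⟨x, hx⟩, hxy⟩
    exact Subtype.ext ((hex y).2 ⟨x, congrArg Subtype.val hxy⟩)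

end StableImage

/-! ### Finiteness of cohomology. -/

/-- Cohomology is a subquotient of the inhomogeneous cochains, which are functions between finite
sets. -/
theorem finite_groupCohomology {k G : Type} [CommRing k] [Group G] [Finite G] (A : Rep.{0} k G)
    [Finite A.V] (n : ℕ) : Finite (groupCohomology A n) := by
  have h₁ : Finite ((groupCohomology.inhomogeneousCochains A).X n) :=
    inferInstanceAs (Finite ((Fin n → G) → A.V))
  have h₂ : Finite (groupCohomology.cocycles A n) :=
    Finite.of_injective _ ((ModuleCat.mono_iff_injective (groupCohomology.iCocycles A n)).1
      inferInstance)
  exact Finite.of_surjective _ ((ModuleCat.epi_iff_surjective (groupCohomology.π A n)).1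
    (inferInstanceAs (Epi ((groupCohomology.inhomogeneousCochains A).homologyπ n))))

/-! ### Cochain-level `[P, φ]`-endomorphisms and their naturality in the coefficients. -/

section Naturality

/-- The coset representatives and the tuples `transferTuple` do not involve the coefficients, and an
equivariant map commutes with the action of each representative. -/
theorem transferCochains_naturality {k G : Type} [CommRing k] [Group G] [Finite G] (P : Subgroup G)
    {A B : Rep.{0} k G} (f : A ⟶ B) :
    transferCochains P A ≫ groupCohomology.cochainsMap (MonoidHom.id G) f =
      groupCohomology.cochainsMap (MonoidHom.id P) ((Rep.resFunctor P.subtype).map f) ≫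
        transferCochains P B := by
  let := Fintype.ofFinite (G ⧸ P)
  apply HomologicalComplex.hom_ext
  intro n
  apply ModuleCat.hom_ext
  apply LinearMap.ext
  intro c
  funext g
  change f.hom ((∑ x : G ⧸ P, (A.ρ x.out).compLeft (Fin n → G) ∘ₗ
      LinearMap.funLeft k A (transferTuple P x)) c g) =
    (∑ x : G ⧸ P, (B.ρ x.out).compLeft (Fin n → G) ∘ₗ
      LinearMap.funLeft k B (transferTuple P x)) (fun h => f.hom (c h)) g
  simp only [LinearMap.sum_apply, Finset.sum_apply, LinearMap.comp_apply,
    LinearMap.compLeft_apply, Function.comp_apply, LinearMap.funLeft_apply, map_sum]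
  exact Finset.sum_congr rfl fun x _ => Rep.hom_comm_apply f _ _

namespace LinkingSystem

variable {S : Type} [Group S] [Finite S] {F : FusionSystem S} {L : LinkingSystem F}
  {k : Type} [CommRing k]

namespace AutChain

/-- The cochain map which induces `AutChain.cohomologyMap`. -/
noncomputable def cochainsMap (M : Rep.{0} k L.fundGroup) : {P R : Subgroup S} → L.AutChain P R →
    (groupCohomology.inhomogeneousCochains (L.coeffOn M R) ⟶
      groupCohomology.inhomogeneousCochains (L.coeffOn M P))
  | _, _, nil _ => 𝟙 _
  | _, _, cons _ ψ h₀ h₁ c => c.cochainsMap M ≫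
      groupCohomology.cochainsMap (restrictHom ψ.hom h₀ h₁) (restrictAct ψ.hom h₀ h₁ M)

/-- Cochain maps are needed because the naturality of connecting homomorphisms applies to morphisms
of short exact sequences of complexes, not to families of maps on cohomology. -/
theorem homologyMap_cochainsMap (M : Rep.{0} k L.fundGroup) (n : ℕ) {P R : Subgroup S}
    (c : L.AutChain P R) :
    HomologicalComplex.homologyMap (c.cochainsMap M) n = c.cohomologyMap M n := by
  induction c with
  | nil P => exact HomologicalComplex.homologyMap_id _ _
  | cons Q ψ h₀ h₁ c ih =>
    exact (HomologicalComplex.homologyMap_comp _ _ _).trans (congrArg (· ≫ _) ih)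

/-- The map of cochains of a subgroup of `S` induced by a morphism of coefficient modules. -/
noncomputable abbrev coeffOnMap {M M' : Rep.{0} k L.fundGroup} (f : M ⟶ M') (P : Subgroup S) :
    groupCohomology.inhomogeneousCochains (L.coeffOn M P) ⟶
      groupCohomology.inhomogeneousCochains (L.coeffOn M' P) :=
  groupCohomology.cochainsMap (MonoidHom.id P)
    ((Rep.resFunctor P.subtype).map ((Rep.resFunctor L.fromS).map f))

/-- Here it matters that `f` is linear over `π_L` and not merely over `S`: it must commute with the
action of `ω(ψ)⁻¹`, which need not come from `S`. -/
theorem restrictAct_naturality {M M' : Rep.{0} k L.fundGroup} (f : M ⟶ M') {Q : L.Obj} (ψ : Q ⟶ Q)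
    {P₀ P₁ : Subgroup S} (h₀ : P₀ ≤ Q.gp)
    (h₁ : (P₀.subgroupOf Q.gp).map (Q.gp.subtype.comp (toHom ψ)) = P₁) :
    groupCohomology.cochainsMap (restrictHom ψ h₀ h₁) (restrictAct ψ h₀ h₁ M) ≫ coeffOnMap f P₀ =
      coeffOnMap f P₁ ≫
        groupCohomology.cochainsMap (restrictHom ψ h₀ h₁) (restrictAct ψ h₀ h₁ M') := by
  apply HomologicalComplex.hom_ext
  intro n
  apply ModuleCat.hom_ext
  apply LinearMap.ext
  intro c
  funext g
  exact Rep.hom_comm_apply f _ _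

theorem cochainsMap_naturality {M M' : Rep.{0} k L.fundGroup} (f : M ⟶ M') {P R : Subgroup S}
    (c : L.AutChain P R) :
    c.cochainsMap M ≫ coeffOnMap f P = coeffOnMap f R ≫ c.cochainsMap M' := by
  induction c with
  | nil P => exact (Category.id_comp _).trans (Category.comp_id _).symm
  | cons Q ψ h₀ h₁ c ih =>
    rw [cochainsMap, cochainsMap, Category.assoc, restrictAct_naturality, reassoc_of% ih]

/-- The cochain map which induces `AutChain.endomorphism`. -/
noncomputable def endomorphismCochains {P R : Subgroup S} (c : L.AutChain P R)
    (M : Rep.{0} k L.fundGroup) :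
    groupCohomology.inhomogeneousCochains (L.coeff M) ⟶
      groupCohomology.inhomogeneousCochains (L.coeff M) :=
  groupCohomology.cochainsMap R.subtype (𝟙 (L.coeffOn M R)) ≫ c.cochainsMap M ≫
    transferCochains P (L.coeff M)

theorem homologyMap_endomorphismCochains {P R : Subgroup S} (c : L.AutChain P R)
    (M : Rep.{0} k L.fundGroup) (n : ℕ) :
    HomologicalComplex.homologyMap (c.endomorphismCochains M) n = c.endomorphism M n := by
  rw [endomorphismCochains, HomologicalComplex.homologyMap_comp,
    HomologicalComplex.homologyMap_comp, homologyMap_cochainsMap]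
  rfl

/-- The coefficient map is moved successively past the transfer, the chain of automorphisms and the
restriction. -/
theorem endomorphismCochains_naturality {P R : Subgroup S} (c : L.AutChain P R)
    {M M' : Rep.{0} k L.fundGroup} (f : M ⟶ M') :
    c.endomorphismCochains M ≫
        groupCohomology.cochainsMap (MonoidHom.id S) ((Rep.resFunctor L.fromS).map f) =
      groupCohomology.cochainsMap (MonoidHom.id S) ((Rep.resFunctor L.fromS).map f) ≫
        c.endomorphismCochains M' := by
  -- Both sides compose a cochain with `f` on one side and with the inclusion of `R` on the other,
  -- and these operations commute definitionally.
  have h : groupCohomology.cochainsMap R.subtype (𝟙 (L.coeffOn M R)) ≫ coeffOnMap f R =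
      groupCohomology.cochainsMap (MonoidHom.id S) ((Rep.resFunctor L.fromS).map f) ≫
        groupCohomology.cochainsMap R.subtype (𝟙 (L.coeffOn M' R)) := rfl
  rw [endomorphismCochains, endomorphismCochains, Category.assoc, Category.assoc,
    transferCochains_naturality]
  change _ ≫ _ ≫ coeffOnMap f P ≫ _ = _
  rw [← Category.assoc (c.cochainsMap M), cochainsMap_naturality, Category.assoc,
    ← Category.assoc, h, Category.assoc]

end AutChain

end LinkingSystem

end Naturality

/-! ### Commutation with the normalized `ω_n`, and stability of the images. -/

namespace OmegaEndomorphism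

variable {p : ℕ} [Fact p.Prime] {S : Type} [Group S] [Finite S] {F : FusionSystem S}
  {L : LinkingSystem F} {Ω : Type*} [Finite Ω] [MulAction (S × S) Ω] (w : OmegaEndomorphism L Ω)

/-- The same components, chains and scalar occur for `M` and for `M'`, so naturality can be checked
one component at a time. -/
theorem map_normalized (n : ℕ) {M M' : CoeffMod p L} (f : M ⟶ M')
    (x : (cohomologyS p L n).obj M) :
    ((cohomologyS p L n).map f).hom (w.normalized M n x) =
      w.normalized M' n (((cohomologyS p L n).map f).hom x) := by
  let := Fintype.ofFinite (MulAction.orbitRel.Quotient (S × S) Ω)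
  refine smul_sum_comm_apply Finset.univ _ (fun o x => ?_) x
  have h := congrArg (HomologicalComplex.homologyMap · n)
    ((w.chain o).endomorphismCochains_naturality f.hom)
  simp only [HomologicalComplex.homologyMap_comp,
    LinkingSystem.AutChain.homologyMap_endomorphismCochains] at h
  exact congrArg (fun g => g.hom x) h

theorem connecting_normalized (n : ℕ) {X : ShortComplex (CoeffMod p L)} (hX : X.ShortExact)
    (x : (cohomologyS p L n).obj X.X₃) :
    (connecting n X hX).hom (w.normalized X.X₃ n x) =
      w.normalized X.X₁ (n + 1) ((connecting n X hX).hom x) := by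
  let := Fintype.ofFinite (MulAction.orbitRel.Quotient (S × S) Ω)
  refine smul_sum_comm_apply Finset.univ _ (fun o x => ?_) x
  have hS := groupCohomology.map_cochainsFunctor_shortExact (shortExact_toRepS hX)
  -- The cochain endomorphisms for the three coefficient modules form an endomorphism of the short
  -- exact sequence of complexes; the connecting homomorphism is natural for it.
  let φ : (X.map (toRepS p L)).map (groupCohomology.cochainsFunctor _ S) ⟶
      (X.map (toRepS p L)).map (groupCohomology.cochainsFunctor _ S) :=
    { τ₁ := (w.chain o).endomorphismCochains X.X₁.obj
      τ₂ := (w.chain o).endomorphismCochains X.X₂.obj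
      τ₃ := (w.chain o).endomorphismCochains X.X₃.obj
      comm₁₂ := (w.chain o).endomorphismCochains_naturality X.f.hom
      comm₂₃ := (w.chain o).endomorphismCochains_naturality X.g.hom }
  have h : connecting n X hX ≫ (w.chain o).endomorphism X.X₁.obj (n + 1) =
      (w.chain o).endomorphism X.X₃.obj n ≫ connecting n X hX := by
    rw [← (w.chain o).homologyMap_endomorphismCochains X.X₁.obj (n + 1),
      ← (w.chain o).homologyMap_endomorphismCochains X.X₃.obj n]
    exact HomologicalComplex.HomologySequence.δ_naturality φ hS hS n (n + 1) rfl
  exact congrArg (fun g => g.hom x) h.symm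

theorem exists_isExponents : ∃ N : ℕ → CoeffMod p L → ℕ, w.IsExponents N := by
  have h (n : ℕ) (M : CoeffMod p L) :
      ∃ N : ℕ, 0 < N ∧ IsIdempotentElem (w.normalized M n ^ N) := by
    have : Finite ((toRepS p L).obj M).V := M.property
    have : Finite ((cohomologyS p L n).obj M) := finite_groupCohomology _ n
    -- The ring `ZLoc p` is infinite, but an endomorphism is determined by its underlying self-map
    -- of a finite set.
    have : Finite (Module.End (ZLoc p) ((cohomologyS p L n).obj M)) :=
      Finite.of_injective _ DFunLike.coe_injective
    exact exists_pow_isIdempotentElem _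
  choose N hN using h
  exact ⟨N, hN⟩

variable {w} {N : ℕ → CoeffMod p L → ℕ}

theorem IsExponents.prod_pos (hN : w.IsExponents N) (M : CoeffMod p L) (n : ℕ) :
    0 < ∏ i ∈ Finset.range (n + 1), N i M :=
  Finset.prod_pos fun i _ => (hN i M).1

/-- The factor `N n M` of the exponent already gives an idempotent, and the other factors raise that
idempotent to a further power. -/
theorem IsExponents.isIdempotentElem_charIdempotent (hN : w.IsExponents N) (M : CoeffMod p L)
    (n : ℕ) : IsIdempotentElem (w.charIdempotent N M n) := by
  rw [charIdempotent, Finset.prod_range_succ, mul_comm, pow_mul]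
  exact (hN n M).2.pow _

/-- The exponents for `M` and `M'` may be unrelated; this is harmless because the images are
eventual images. -/
theorem IsExponents.map_mem_image (hN : w.IsExponents N) (n : ℕ) (M M' : CoeffMod p L)
    (f : M ⟶ M') (x : (cohomologyS p L n).obj M) (hx : x ∈ w.image N M n) :
    ((cohomologyS p L n).map f).hom x ∈ w.image N M' n :=
  map_mem_range_pow (w.map_normalized n f) (hN.prod_pos M n)
    (hN.isIdempotentElem_charIdempotent M n) hx

theorem IsExponents.connecting_mem_image (hN : w.IsExponents N) (n : ℕ)
    (X : ShortComplex (CoeffMod p L)) (hX : X.ShortExact) (x : (cohomologyS p L n).obj X.X₃)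
    (hx : x ∈ w.image N X.X₃ n) : (connecting n X hX).hom x ∈ w.image N X.X₁ (n + 1) :=
  map_mem_range_pow (w.connecting_normalized n hX) (hN.prod_pos X.X₃ n)
    (hN.isIdempotentElem_charIdempotent X.X₃ n) hx

end OmegaEndomorphism

/-! ### The `δ`-functor properties of `H^*(S, -)`. -/

theorem groupCohomology_map_add {k G : Type} [CommRing k] [Group G] {A B : Rep.{0} k G}
    (f g : A ⟶ B) (n : ℕ) :
    groupCohomology.map (MonoidHom.id G) (f + g) n =
      groupCohomology.map (MonoidHom.id G) f n + groupCohomology.map (MonoidHom.id G) g n := by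
  have h : groupCohomology.cochainsMap (MonoidHom.id G) (f + g) =
      groupCohomology.cochainsMap (MonoidHom.id G) f +
        groupCohomology.cochainsMap (MonoidHom.id G) g := by
    apply HomologicalComplex.hom_ext
    intro i
    apply ModuleCat.hom_ext
    apply LinearMap.ext
    intro c
    rfl
  rw [groupCohomology.map, h, HomologicalComplex.homologyMap_add]
  rfl

theorem cohomologyS_map_add {p : ℕ} [Fact p.Prime] {S : Type} [Group S] [Finite S]
    {F : FusionSystem S} {L : LinkingSystem F} (n : ℕ) {M M' : CoeffMod p L} (f g : M ⟶ M') :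
    (cohomologyS p L n).map (f + g) = (cohomologyS p L n).map f + (cohomologyS p L n).map g :=
  groupCohomology_map_add ((toRepS p L).map f) ((toRepS p L).map g) n

theorem exact_of_function_exact {k : Type} [CommRing k] {A B C : ModuleCat.{0} k} (f : A ⟶ B)
    (g : B ⟶ C) (h : Function.Exact f.hom g.hom) :
    ∃ w : f ≫ g = 0, (ShortComplex.mk f g w).Exact :=
  ⟨ModuleCat.hom_ext h.linearMap_comp_eq_zero,
    (ShortComplex.ShortExact.moduleCat_exact_iff_function_exact _).2 h⟩

/-- A morphism of short exact sequences of modules induces one of short exact sequences of cochain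
complexes. -/
theorem connecting_naturality {p : ℕ} [Fact p.Prime] {S : Type} [Group S] [Finite S]
    {F : FusionSystem S} {L : LinkingSystem F} (n : ℕ) {X Y : ShortComplex (CoeffMod p L)}
    (hX : X.ShortExact) (hY : Y.ShortExact) (φ : X ⟶ Y) :
    connecting n X hX ≫ (cohomologyS p L (n + 1)).map φ.τ₁ =
      (cohomologyS p L n).map φ.τ₃ ≫ connecting n Y hY :=
  HomologicalComplex.HomologySequence.δ_naturality
    ((groupCohomology.cochainsFunctor _ S).mapShortComplex.map
      ((toRepS p L).mapShortComplex.map φ))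
    (groupCohomology.map_cochainsFunctor_shortExact (shortExact_toRepS hX))
    (groupCohomology.map_cochainsFunctor_shortExact (shortExact_toRepS hY)) n (n + 1) rfl

theorem injective_cohomologyS_map_zero {p : ℕ} [Fact p.Prime] {S : Type} [Group S] [Finite S]
    {F : FusionSystem S} {L : LinkingSystem F} {X : ShortComplex (CoeffMod p L)}
    (hX : X.ShortExact) : Function.Injective ((cohomologyS p L 0).map X.f).hom := by
  have : Mono ((toRepS p L).map X.f) := (shortExact_toRepS hX).mono_f
  exact (ModuleCat.mono_iff_injective _).1
    (groupCohomology.mono_map_0_of_mono ((toRepS p L).map X.f))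

/-! ### The long exact sequence of the images. -/

namespace OmegaEndomorphism.IsExponents

variable {p : ℕ} [Fact p.Prime] {S : Type} [Group S] [Finite S] {F : FusionSystem S}
  {L : LinkingSystem F} {Ω : Type*} [Finite Ω] [MulAction (S × S) Ω] {w : OmegaEndomorphism L Ω}
  {N : ℕ → CoeffMod p L → ℕ}

/-- In this and the next two lemmas, exactness for `H^*(S, -)` restricts to the images by
`exact_restrict_range_pow`, with the idempotent taken at the middle term of the pair. -/
theorem exact_middle (hN : w.IsExponents N) (n : ℕ) {X : ShortComplex (CoeffMod p L)}
    (hX : X.ShortExact) :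
    Function.Exact
      (((cohomologyS p L n).map X.f).hom.restrict (hN.map_mem_image n _ _ X.f))
      (((cohomologyS p L n).map X.g).hom.restrict (hN.map_mem_image n _ _ X.g)) :=
  exact_restrict_range_pow
    ((ShortComplex.ShortExact.moduleCat_exact_iff_function_exact _).1
      (groupCohomology.mapShortComplex₂_exact (shortExact_toRepS hX) n))
    (w.map_normalized n X.f) (hN.prod_pos X.X₂ n) (hN.isIdempotentElem_charIdempotent X.X₂ n)
    _ _ _

theorem exact_right (hN : w.IsExponents N) (n : ℕ) {X : ShortComplex (CoeffMod p L)}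
    (hX : X.ShortExact) :
    Function.Exact
      (((cohomologyS p L n).map X.g).hom.restrict (hN.map_mem_image n _ _ X.g))
      ((connecting n X hX).hom.restrict (hN.connecting_mem_image n X hX)) :=
  exact_restrict_range_pow
    ((ShortComplex.ShortExact.moduleCat_exact_iff_function_exact _).1
      (groupCohomology.mapShortComplex₃_exact (shortExact_toRepS hX) (Eq.refl (n + 1))))
    (w.map_normalized n X.g) (hN.prod_pos X.X₃ n) (hN.isIdempotentElem_charIdempotent X.X₃ n)
    _ _ _

theorem exact_left (hN : w.IsExponents N) (n : ℕ) {X : ShortComplex (CoeffMod p L)}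
    (hX : X.ShortExact) :
    Function.Exact
      ((connecting n X hX).hom.restrict (hN.connecting_mem_image n X hX))
      (((cohomologyS p L (n + 1)).map X.f).hom.restrict (hN.map_mem_image (n + 1) _ _ X.f)) :=
  exact_restrict_range_pow
    ((ShortComplex.ShortExact.moduleCat_exact_iff_function_exact _).1
      (groupCohomology.mapShortComplex₁_exact (shortExact_toRepS hX) (Eq.refl (n + 1))))
    (w.connecting_normalized n hX) (hN.prod_pos X.X₁ (n + 1))
    (hN.isIdempotentElem_charIdempotent X.X₁ (n + 1)) _ _ _

/-- Additivity, naturality and injectivity in degree `0` are inherited by restriction to submodules;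
only the exactness statements use the idempotents again. -/
theorem isDeltaFunctor (hN : w.IsExponents N) :
    IsDeltaFunctor (w.imageFunctor N hN.map_mem_image)
      (w.imageConnecting N hN.connecting_mem_image) where
  additive n :=
    { map_add := by
        intro M M' f g
        apply ModuleCat.hom_ext
        apply LinearMap.ext
        intro (x : w.image N M n)
        apply Subtype.ext
        exact congrArg (fun h => h.hom (x : (cohomologyS p L n).obj M))
          (cohomologyS_map_add n f g) }
  naturality n {X Y} hX hY φ := by
    apply ModuleCat.hom_ext
    apply LinearMap.ext
    intro (x : w.image N X.X₃ n)
    apply Subtype.ext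
    exact congrArg (fun h => h.hom (x : (cohomologyS p L n).obj X.X₃))
      (connecting_naturality n hX hY φ)
  mono_zero {X} hX := by
    refine (ModuleCat.mono_iff_injective _).2 fun (x y : w.image N X.X₁ 0) hxy => ?_
    exact Subtype.ext (injective_cohomologyS_map_zero hX (congrArg Subtype.val hxy))
  exact_middle n {_} hX := exact_of_function_exact _ _ (hN.exact_middle n hX)
  exact_right n {_} hX := exact_of_function_exact _ _ (hN.exact_right n hX)
  exact_left n {_} hX := exact_of_function_exact _ _ (hN.exact_left n hX)

end OmegaEndomorphism.IsExponents

end PLocalFiniteGroup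

open PLocalFiniteGroup in
theorem theorem4p14 (p : ℕ) [Fact p.Prime] {S : Type} [Group S] [Finite S] (hS : IsPGroup p S)
    (F : FusionSystem S) (hF : F.IsSaturated p) (L : LinkingSystem F)
    {Ω : Type*} [Finite Ω] [MulAction (S × S) Ω] (hΩ : IsCharacteristicBiset p F Ω)
    (w : OmegaEndomorphism L Ω) :
    (∃ N : ℕ → CoeffMod p L → ℕ, w.IsExponents N) ∧
    ∀ N : ℕ → CoeffMod p L → ℕ, w.IsExponents N →
      (∀ (M : CoeffMod p L) (n : ℕ), IsIdempotentElem (w.charIdempotent N M n)) ∧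
      ∃ (hmap : ∀ (n : ℕ) (M M' : CoeffMod p L) (f : M ⟶ M'), ∀ x ∈ w.image N M n,
          ((cohomologyS p L n).map f).hom x ∈ w.image N M' n)
        (hδ : ∀ (n : ℕ) (X : ShortComplex (CoeffMod p L)) (hX : X.ShortExact),
          ∀ x ∈ w.image N X.X₃ n, (connecting n X hX).hom x ∈ w.image N X.X₁ (n + 1)),
        IsDeltaFunctor (w.imageFunctor N hmap) (w.imageConnecting N hδ) :=
  ⟨w.exists_isExponents, fun _ hN => ⟨hN.isIdempotentElem_charIdempotent, hN.map_mem_image,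
    hN.connecting_mem_image, hN.isDeltaFunctor⟩⟩
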